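/- **Map-level stability under regularization.** Let $K\subset\mathbb{R}^d$ be compact and $c(x,y)=\tfrac12|x-y|^2$. For $V:K\to\mathbb{R}$ put $$V^c(x)=\inf_{y\in K}\bigl[c(x,y)-V(y)\bigr],\qquad x\in\mathbb{R}^d,\qquad V^{cc}:=\bigl(V^c|_K\bigr)^c .$$ For probability measures $\mu,\nu$ concentrated on $K$, call $(V,T)$ an *optimal solution for $(\mu,\nu)$* if $V\in C(K)$ maximizes $W\mapsto\inf_S\mathcal L(W,S)$ over $C(K)$ and $T$ minimizes $S\mapsto\mathcal L(V,S)$, where $S$ and $T$ range over the ($\mu$-measurable) maps $K\to K$ and $$\mathcal L(V,T)=\int_K \bigl[c(x,T(x))-V(T(x))\bigr]\,d\mu(x)+\int_K V\,d\nu .$$ An *optimal Monge map from $\mu$ to $\nu$* is a map $T:K\to K$ with $T_\#\mu=\nu$ which minimizes $\int c(x,T(x))\,d\mu(x)$ among all such maps. Let $(\mu_\varepsilon)_{\varepsilon>0}$ be probability measures concentrated on $K$ with $\mu_\varepsilon\ll\mathcal L^d$ and $\mu_\varepsilon\rightharpoonup\mu$ weakly as $\varepsilon\downarrow0$, and let $\nu$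 be a probability measure concentrated on $K$. For each $\varepsilon>0$ let $(V_\varepsilon,T_\varepsilon)$ be an optimal solution for $(\mu_\varepsilon,\nu)$. Then: * For every $\varepsilon>0$, $(V_\varepsilon^{cc},T_\varepsilon)$ is also an optimal solution for $(\mu_\varepsilon,\nu)$. * Let $\widehat V_\varepsilon:=V_\varepsilon^{cc}-V_\varepsilon^{cc}(0)$, i.e. $V_\varepsilon^{cc}$ normalized to vanish at $0$. Every sequence $\varepsilon_k\downarrow0$ has a subsequence along which $\widehat V_{\varepsilon}$ converges uniformly on $K$. Moreover, let $V_0$ be the uniform limit on $K$ of $\widehat V_{\varepsilon_k}$ for some sequence $\varepsilon_k\downarrow 0$, and suppose that $V_0^c$ (as a function on $\mathbb{R}^d$) is differentiable at $\mu$-a.e. point. Then: 1. $T_0(x):=x-\nabla V_0^c(x)$ (with $T_0(x):=x$ on the $\mu$-null set where $V_0^c$ is not differentiable) is an optimal Monge map from $\mu$ to $\nu$. 2. If, in addition, each $V_\varepsilon^c$, $\varepsilon>0$, is differentiable on $K$ (differentiability relative to $K$ suffices), then for $\mu$-a.e. $x$ there are points $x_\varepsilon\in K$, $\varepsilon>0$,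 with $x_\varepsilon\to x$ and $T_\varepsilon(x_\varepsilon)\to T_0(x)$ as $\varepsilon\downarrow0$. Moreover, $(V_0,T_0)$ is an optimal solution for $(\mu,\nu)$. -/

import Mathlib

open MeasureTheory Filter Topology Set

noncomputable section

namespace SemiDualOT

/-- The quadratic cost `c(x, y) = |x - y|² / 2` on `ℝᵈ`. -/
def cost {d : ℕ} (x y : EuclideanSpace ℝ (Fin d)) : ℝ := (1 / 2) * ‖x - y‖ ^ 2

/-- The `c`-transform `V^c(x) = inf_{y ∈ K} (c(x, y) - V(y))`. Only the values of `V` on `K` matter;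
the formula is used for every `x ∈ ℝᵈ`, so `V^c` is a function on all of `ℝᵈ`.
Since the cost is symmetric, `V^{cc}` is `cTransform K (cTransform K V)`. -/
def cTransform {d : ℕ} (K : Set (EuclideanSpace ℝ (Fin d))) (V : EuclideanSpace ℝ (Fin d) → ℝ)
    (x : EuclideanSpace ℝ (Fin d)) : ℝ :=
  ⨅ y : K, (cost x y - V y)

/-- The potential `V^{cc}` shifted by a constant so that its value at the origin is `0`. -/
def normalizedPotential {d : ℕ} (K : Set (EuclideanSpace ℝ (Fin d)))
    (V : EuclideanSpace ℝ (Fin d) → ℝ) (y : EuclideanSpace ℝ (Fin d)) : ℝ :=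
  cTransform K (cTransform K V) y - cTransform K (cTransform K V) 0

/-- The candidate maps `T : K → K`: measurable up to `μ`-null sets. The values of `T` outside `K`
are irrelevant, because all source measures are concentrated on `K`. -/
def candidateMaps {d : ℕ} (K : Set (EuclideanSpace ℝ (Fin d)))
    (μ : Measure (EuclideanSpace ℝ (Fin d))) :
    Set (EuclideanSpace ℝ (Fin d) → EuclideanSpace ℝ (Fin d)) :=
  {T | AEMeasurable T μ ∧ MapsTo T K K}

/-- The semi-dual objective `L(V, T) = ∫ (c(x, T x) - V(T x)) dμ(x) + ∫ V dν`. -/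
def lagrangian {d : ℕ} (μ ν : Measure (EuclideanSpace ℝ (Fin d)))
    (V : EuclideanSpace ℝ (Fin d) → ℝ)
    (T : EuclideanSpace ℝ (Fin d) → EuclideanSpace ℝ (Fin d)) : ℝ :=
  (∫ x, (cost x (T x) - V (T x)) ∂μ) + ∫ y, V y ∂ν

/-- `(V, T)` is an optimal solution of the max-min problem `sup_{V ∈ C(K)} inf_{T : K → K} L(V, T)`:
`V` maximizes `W ↦ inf_S L(W, S)` over the continuous functions on `K`,
and `T` minimizes `S ↦ L(V, S)`. -/
structure IsOptimalPair {d : ℕ} (K : Set (EuclideanSpace ℝ (Fin d)))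
    (μ ν : Measure (EuclideanSpace ℝ (Fin d)))
    (V : EuclideanSpace ℝ (Fin d) → ℝ)
    (T : EuclideanSpace ℝ (Fin d) → EuclideanSpace ℝ (Fin d)) : Prop where
  continuousOn : ContinuousOn V K
  isMax : ∀ W : EuclideanSpace ℝ (Fin d) → ℝ, ContinuousOn W K →
    (⨅ S : candidateMaps K μ, lagrangian μ ν W S) ≤ ⨅ S : candidateMaps K μ, lagrangian μ ν V S
  mem : T ∈ candidateMaps K μ
  isMin : ∀ S ∈ candidateMaps K μ, lagrangian μ ν V T ≤ lagrangian μ ν V S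

/-- `T` is an optimal Monge map from `μ` to `ν`: it pushes `μ` forward to `ν` and has the least
transport cost among all maps `K → K` that do so. -/
structure IsOptimalMongeMap {d : ℕ} (K : Set (EuclideanSpace ℝ (Fin d)))
    (μ ν : Measure (EuclideanSpace ℝ (Fin d)))
    (T : EuclideanSpace ℝ (Fin d) → EuclideanSpace ℝ (Fin d)) : Prop where
  mem : T ∈ candidateMaps K μ
  map_eq : μ.map T = ν
  isMin : ∀ S ∈ candidateMaps K μ, μ.map S = ν →
    ∫ x, cost x (T x) ∂μ ≤ ∫ x, cost x (S x) ∂μ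

/-- The map `T₀(x) = x - ∇V^c(x)` recovered from a potential `V`. -/
def recoveredMap {d : ℕ} (K : Set (EuclideanSpace ℝ (Fin d)))
    (V : EuclideanSpace ℝ (Fin d) → ℝ) (x : EuclideanSpace ℝ (Fin d)) :
    EuclideanSpace ℝ (Fin d) :=
  x - gradient (cTransform K V) x

end SemiDualOT

end

namespace SemiDualOT

variable {d : ℕ} {K : Set (EuclideanSpace ℝ (Fin d))}

/-! ### The quadratic cost and the `c`-transform -/

lemma cost_comm (x y : EuclideanSpace ℝ (Fin d)) : cost x y = cost y x := by
  simp [cost, norm_sub_rev]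

lemma continuous_cost : Continuous fun p : EuclideanSpace ℝ (Fin d) × EuclideanSpace ℝ (Fin d) =>
    cost p.1 p.2 := by
  unfold cost; fun_prop

lemma continuous_cost_left (y : EuclideanSpace ℝ (Fin d)) : Continuous fun x => cost x y := by
  unfold cost; fun_prop

lemma continuous_cost_right (x : EuclideanSpace ℝ (Fin d)) : Continuous fun y => cost x y := by
  unfold cost; fun_prop

lemma cost_eq (x y : EuclideanSpace ℝ (Fin d)) :
    cost x y = (1 / 2) * ‖x‖ ^ 2 - inner ℝ x y + (1 / 2) * ‖y‖ ^ 2 := by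
  rw [cost, norm_sub_sq_real]; ring

lemma continuousOn_cost_sub {V : EuclideanSpace ℝ (Fin d) → ℝ} (hV : ContinuousOn V K)
    (x : EuclideanSpace ℝ (Fin d)) : ContinuousOn (fun y => cost x y - V y) K :=
  (continuous_cost_right x).continuousOn.sub hV

lemma bddBelow_cost_sub (hK : IsCompact K) {V : EuclideanSpace ℝ (Fin d) → ℝ}
    (hV : ContinuousOn V K) (x : EuclideanSpace ℝ (Fin d)) :
    BddBelow (range fun y : K => cost x y - V y) := by
  have h := (hK.image_of_continuousOn (continuousOn_cost_sub hV x)).bddBelow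
  rwa [image_eq_range] at h

lemma cTransform_le (hK : IsCompact K) {V : EuclideanSpace ℝ (Fin d) → ℝ} (hV : ContinuousOn V K)
    (x : EuclideanSpace ℝ (Fin d)) {y : EuclideanSpace ℝ (Fin d)} (hy : y ∈ K) :
    cTransform K V x ≤ cost x y - V y :=
  ciInf_le (bddBelow_cost_sub hK hV x) ⟨y, hy⟩

lemma le_cTransform (hne : K.Nonempty) {V : EuclideanSpace ℝ (Fin d) → ℝ}
    {x : EuclideanSpace ℝ (Fin d)} {a : ℝ} (h : ∀ y ∈ K, a ≤ cost x y - V y) :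
    a ≤ cTransform K V x := by
  have := hne.to_subtype
  exact le_ciInf fun y => h y y.2

lemma exists_cTransform_eq (hK : IsCompact K) (hne : K.Nonempty)
    {V : EuclideanSpace ℝ (Fin d) → ℝ} (hV : ContinuousOn V K) (x : EuclideanSpace ℝ (Fin d)) :
    ∃ y ∈ K, cTransform K V x = cost x y - V y := by
  obtain ⟨y, hy, hmin⟩ := hK.exists_isMinOn hne (continuousOn_cost_sub hV x)
  exact ⟨y, hy, le_antisymm (cTransform_le hK hV x hy) (le_cTransform hne fun z hz => hmin hz)⟩

lemma cTransform_sub_le (hK : IsCompact K) (hne : K.Nonempty)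
    {V W : EuclideanSpace ℝ (Fin d) → ℝ} (hV : ContinuousOn V K) {a : ℝ}
    (h : ∀ y ∈ K, W y ≤ V y + a) (x : EuclideanSpace ℝ (Fin d)) :
    cTransform K V x - a ≤ cTransform K W x :=
  le_cTransform hne fun y hy => by linarith [cTransform_le hK hV x hy, h y hy]

lemma abs_cTransform_sub_le (hK : IsCompact K) (hne : K.Nonempty)
    {V W : EuclideanSpace ℝ (Fin d) → ℝ} (hV : ContinuousOn V K) (hW : ContinuousOn W K) {a : ℝ}
    (h : ∀ y ∈ K, |W y - V y| ≤ a) (x : EuclideanSpace ℝ (Fin d)) :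
    |cTransform K W x - cTransform K V x| ≤ a := by
  rw [abs_le]
  constructor
  · linarith [cTransform_sub_le hK hne hV (W := W) (a := a)
      (fun y hy => by linarith [(abs_le.1 (h y hy)).2]) x]
  · linarith [cTransform_sub_le hK hne hW (W := V) (a := a)
      (fun y hy => by linarith [(abs_le.1 (h y hy)).1]) x]

lemma cTransform_sub_const (hK : IsCompact K) (hne : K.Nonempty)
    {V : EuclideanSpace ℝ (Fin d) → ℝ} (hV : ContinuousOn V K) (a : ℝ)
    (x : EuclideanSpace ℝ (Fin d)) :
    cTransform K (fun y => V y - a) x = cTransform K V x + a := by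
  have h1 := cTransform_sub_le hK hne hV (W := fun y => V y - a) (a := -a)
    (fun y _ => by linarith) x
  have h2 := cTransform_sub_le hK hne (V := fun y => V y - a) (hV.sub continuousOn_const) (W := V)
    (a := a) (fun y _ => by simp) x
  linarith

lemma lipschitzWith_cTransform_sub (hK : IsCompact K) (hne : K.Nonempty)
    {V : EuclideanSpace ℝ (Fin d) → ℝ} (hV : ContinuousOn V K) {R : NNReal}
    (hR : ∀ y ∈ K, ‖y‖ ≤ R) :
    LipschitzWith R fun x => cTransform K V x - (1 / 2) * ‖x‖ ^ 2 := by
  refine LipschitzWith.of_le_add_mul R fun x z => ?_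
  obtain ⟨y, hy, hzy⟩ := exists_cTransform_eq hK hne hV z
  have h1 := cTransform_le hK hV x hy
  have h2 : inner ℝ (z - x) y ≤ R * dist x z := by
    calc inner ℝ (z - x) y ≤ ‖z - x‖ * ‖y‖ := real_inner_le_norm _ _
      _ ≤ ‖z - x‖ * R := by gcongr; exact hR y hy
      _ = R * dist x z := by rw [dist_comm, dist_eq_norm, mul_comm]
  rw [inner_sub_left] at h2
  rw [cost_eq] at h1 hzy
  linarith

lemma exists_norm_le (hK : IsCompact K) : ∃ R : NNReal, ∀ y ∈ K, ‖y‖ ≤ R := by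
  obtain ⟨C, hC⟩ := hK.isBounded.exists_norm_le
  exact ⟨C.toNNReal, fun y hy => (hC y hy).trans (Real.le_coe_toNNReal C)⟩

lemma continuous_cTransform (hK : IsCompact K) (hne : K.Nonempty)
    {V : EuclideanSpace ℝ (Fin d) → ℝ} (hV : ContinuousOn V K) :
    Continuous (cTransform K V) := by
  obtain ⟨R, hR⟩ := exists_norm_le hK
  have h := (lipschitzWith_cTransform_sub hK hne hV hR).continuous
  have h2 : Continuous fun x : EuclideanSpace ℝ (Fin d) => (1 / 2) * ‖x‖ ^ 2 := by fun_prop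
  exact (h.add h2).congr fun x => sub_add_cancel _ _

lemma ae_differentiableAt_cTransform (hK : IsCompact K) (hne : K.Nonempty)
    {V : EuclideanSpace ℝ (Fin d) → ℝ} (hV : ContinuousOn V K) :
    ∀ᵐ x, DifferentiableAt ℝ (cTransform K V) x := by
  obtain ⟨R, hR⟩ := exists_norm_le hK
  filter_upwards [(lipschitzWith_cTransform_sub hK hne hV hR).ae_differentiableAt] with x hx
  have h2 : DifferentiableAt ℝ (fun x : EuclideanSpace ℝ (Fin d) => (1 / 2) * ‖x‖ ^ 2) x :=
    ((contDiff_norm_sq ℝ).differentiable one_ne_zero x).const_mul _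
  exact (hx.add h2).congr_of_eventuallyEq (Eventually.of_forall fun z => (sub_add_cancel _ _).symm)

lemma le_cTransform_cTransform (hK : IsCompact K) {V : EuclideanSpace ℝ (Fin d) → ℝ}
    (hV : ContinuousOn V K) {y : EuclideanSpace ℝ (Fin d)} (hy : y ∈ K) :
    V y ≤ cTransform K (cTransform K V) y :=
  le_cTransform ⟨y, hy⟩ fun x _ => by linarith [cTransform_le hK hV x hy, cost_comm x y]

lemma cTransform_cTransform_cTransform (hK : IsCompact K) {V : EuclideanSpace ℝ (Fin d) → ℝ}
    (hV : ContinuousOn V K) {x : EuclideanSpace ℝ (Fin d)} (hx : x ∈ K) :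
    cTransform K (cTransform K (cTransform K V)) x = cTransform K V x := by
  have hne : K.Nonempty := ⟨x, hx⟩
  have hc := continuous_cTransform hK hne hV
  refine le_antisymm ?_ (le_cTransform_cTransform hK hc.continuousOn hx)
  have := cTransform_sub_le hK hne (continuous_cTransform hK hne hc.continuousOn).continuousOn
    (W := V) (a := 0) (fun y hy => by simpa using le_cTransform_cTransform hK hV hy) x
  simpa using this

/-- Where `V^c` is differentiable, the point attaining the infimum is `x - ∇V^c(x)`. -/
lemma recoveredMap_eq (hK : IsCompact K) {V : EuclideanSpace ℝ (Fin d) → ℝ}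
    (hV : ContinuousOn V K) {x y : EuclideanSpace ℝ (Fin d)} (hy : y ∈ K)
    (hxy : cTransform K V x = cost x y - V y) (hd : DifferentiableAt ℝ (cTransform K V) x) :
    recoveredMap K V x = y := by
  have h1 : HasFDerivAt (fun z : EuclideanSpace ℝ (Fin d) => cost z y)
      (innerSL ℝ (x - y)) x := by
    have h := ((hasFDerivAt_id (𝕜 := ℝ) x).sub_const y).norm_sq.const_mul (1 / 2 : ℝ)
    refine h.congr_fderiv ?_
    ext v
    simp
  have h2 : HasFDerivAt (fun z => cTransform K V z - cost z y)
      (fderiv ℝ (cTransform K V) x - innerSL ℝ (x - y)) x := hd.hasFDerivAt.sub h1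
  have hmax : IsLocalMax (fun z => cTransform K V z - cost z y) x :=
    Eventually.of_forall fun z => by
      have := cTransform_le hK hV z hy
      dsimp only
      linarith
  have h3 := sub_eq_zero.1 (hmax.hasFDerivAt_eq_zero h2)
  have h4 : gradient (cTransform K V) x = x - y := by
    rw [gradient, h3]
    exact (InnerProductSpace.toDual ℝ _).symm_apply_apply (x - y)
  rw [recoveredMap, h4, sub_sub_cancel]

lemma recoveredMap_of_not_differentiableAt {V : EuclideanSpace ℝ (Fin d) → ℝ}
    {x : EuclideanSpace ℝ (Fin d)} (hd : ¬ DifferentiableAt ℝ (cTransform K V) x) :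
    recoveredMap K V x = x := by
  rw [recoveredMap, gradient_eq_zero_of_not_differentiableAt hd, sub_zero]

lemma measurable_recoveredMap (V : EuclideanSpace ℝ (Fin d) → ℝ) :
    Measurable (recoveredMap K V) := by
  have h : Measurable (gradient (cTransform K V)) :=
    (InnerProductSpace.toDual ℝ (EuclideanSpace ℝ (Fin d))).symm.continuous.measurable.comp
      (measurable_fderiv ℝ (cTransform K V))
  exact measurable_id.sub h

lemma recoveredMap_mem_and_eq (hK : IsCompact K) (hne : K.Nonempty)
    {V : EuclideanSpace ℝ (Fin d) → ℝ} (hV : ContinuousOn V K) {x : EuclideanSpace ℝ (Fin d)}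
    (hd : DifferentiableAt ℝ (cTransform K V) x) :
    recoveredMap K V x ∈ K ∧
      cTransform K V x = cost x (recoveredMap K V x) - V (recoveredMap K V x) := by
  obtain ⟨y, hy, hxy⟩ := exists_cTransform_eq hK hne hV x
  rw [recoveredMap_eq hK hV hy hxy hd]
  exact ⟨hy, hxy⟩

lemma recoveredMap_mem_candidateMaps (hK : IsCompact K) {V : EuclideanSpace ℝ (Fin d) → ℝ}
    (hV : ContinuousOn V K) (μ : Measure (EuclideanSpace ℝ (Fin d))) :
    recoveredMap K V ∈ candidateMaps K μ := by
  refine ⟨(measurable_recoveredMap V).aemeasurable, fun x hx => ?_⟩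
  by_cases hd : DifferentiableAt ℝ (cTransform K V) x
  · exact (recoveredMap_mem_and_eq hK ⟨x, hx⟩ hV hd).1
  · rwa [recoveredMap_of_not_differentiableAt hd]

/-! ### The dual objective -/

/-- The dual objective `∫ V^c dμ + ∫ V dν`. -/
noncomputable def dualValue (K : Set (EuclideanSpace ℝ (Fin d)))
    (μ ν : Measure (EuclideanSpace ℝ (Fin d))) (V : EuclideanSpace ℝ (Fin d) → ℝ) : ℝ :=
  (∫ x, cTransform K V x ∂μ) + ∫ y, V y ∂ν

/-- `V` is a continuous maximizer of the dual objective. -/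
def IsDualMaximizer (K : Set (EuclideanSpace ℝ (Fin d)))
    (μ ν : Measure (EuclideanSpace ℝ (Fin d))) (V : EuclideanSpace ℝ (Fin d) → ℝ) : Prop :=
  ContinuousOn V K ∧ ∀ W, ContinuousOn W K → dualValue K μ ν W ≤ dualValue K μ ν V

lemma ae_mem_of_compl {μ : Measure (EuclideanSpace ℝ (Fin d))} (hμ : μ Kᶜ = 0) :
    ∀ᵐ x ∂μ, x ∈ K := by
  rw [ae_iff]; exact hμ

lemma nonempty_of_measure_compl {μ : Measure (EuclideanSpace ℝ (Fin d))} [IsProbabilityMeasure μ]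
    (hμ : μ Kᶜ = 0) : K.Nonempty :=
  (ae_mem_of_compl hμ).exists.imp fun _ h => h

lemma integrable_comp_candidate (hK : IsCompact K) {μ : Measure (EuclideanSpace ℝ (Fin d))}
    [IsFiniteMeasure μ] (hμ : μ Kᶜ = 0)
    {F : EuclideanSpace ℝ (Fin d) × EuclideanSpace ℝ (Fin d) → ℝ} (hF : ContinuousOn F (K ×ˢ K))
    {S : EuclideanSpace ℝ (Fin d) → EuclideanSpace ℝ (Fin d)} (hS : S ∈ candidateMaps K μ) :
    Integrable (fun x => F (x, S x)) μ := by
  have hm : AEMeasurable (fun x => (x, S x)) μ := aemeasurable_id.prodMk hS.1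
  have hKK := hK.prod hK
  have hmem : ∀ᵐ x ∂μ, (x, S x) ∈ K ×ˢ K := by
    filter_upwards [ae_mem_of_compl hμ] with x hx using ⟨hx, hS.2 hx⟩
  have hres : (μ.map fun x => (x, S x)).restrict (K ×ˢ K) = μ.map fun x => (x, S x) :=
    Measure.restrict_eq_self_of_ae_mem
      ((ae_map_iff hm hKK.isClosed.measurableSet).2 hmem)
  have hsm : AEStronglyMeasurable F (μ.map fun x => (x, S x)) := by
    rw [← hres]
    exact hF.aestronglyMeasurable hKK.isClosed.measurableSet
  obtain ⟨C, hC⟩ := hKK.exists_bound_of_continuousOn hF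
  refine Integrable.of_bound (hsm.comp_aemeasurable hm) C ?_
  filter_upwards [hmem] with x hx using hC _ hx

lemma id_mem_candidateMaps (μ : Measure (EuclideanSpace ℝ (Fin d))) :
    (id : EuclideanSpace ℝ (Fin d) → _) ∈ candidateMaps K μ :=
  ⟨aemeasurable_id, fun _ hx => hx⟩

lemma integrable_of_continuousOn (hK : IsCompact K) {μ : Measure (EuclideanSpace ℝ (Fin d))}
    [IsFiniteMeasure μ] (hμ : μ Kᶜ = 0) {f : EuclideanSpace ℝ (Fin d) → ℝ}
    (hf : ContinuousOn f K) : Integrable f μ :=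
  integrable_comp_candidate hK hμ (F := fun p => f p.1)
    (hf.comp continuousOn_fst fun _ hp => hp.1) (id_mem_candidateMaps μ)

lemma integrable_cost_sub (hK : IsCompact K) {μ : Measure (EuclideanSpace ℝ (Fin d))}
    [IsFiniteMeasure μ] (hμ : μ Kᶜ = 0) {V : EuclideanSpace ℝ (Fin d) → ℝ}
    (hV : ContinuousOn V K) {S : EuclideanSpace ℝ (Fin d) → EuclideanSpace ℝ (Fin d)}
    (hS : S ∈ candidateMaps K μ) : Integrable (fun x => cost x (S x) - V (S x)) μ :=
  integrable_comp_candidate hK hμ (F := fun p => cost p.1 p.2 - V p.2)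
    (continuous_cost.continuousOn.sub (hV.comp continuousOn_snd fun _ hp => hp.2)) hS

lemma integrable_cTransform (hK : IsCompact K) {μ : Measure (EuclideanSpace ℝ (Fin d))}
    [IsProbabilityMeasure μ] (hμ : μ Kᶜ = 0) {V : EuclideanSpace ℝ (Fin d) → ℝ}
    (hV : ContinuousOn V K) : Integrable (cTransform K V) μ :=
  integrable_of_continuousOn hK hμ
    (continuous_cTransform hK (nonempty_of_measure_compl hμ) hV).continuousOn

lemma cTransform_le_candidate (hK : IsCompact K) {μ : Measure (EuclideanSpace ℝ (Fin d))}
    (hμ : μ Kᶜ = 0) {V : EuclideanSpace ℝ (Fin d) → ℝ}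
    (hV : ContinuousOn V K) {S : EuclideanSpace ℝ (Fin d) → EuclideanSpace ℝ (Fin d)}
    (hS : S ∈ candidateMaps K μ) :
    ∀ᵐ x ∂μ, cTransform K V x ≤ cost x (S x) - V (S x) := by
  filter_upwards [ae_mem_of_compl hμ] with x hx using cTransform_le hK hV x (hS.2 hx)

lemma dualValue_le_lagrangian (hK : IsCompact K) {μ ν : Measure (EuclideanSpace ℝ (Fin d))}
    [IsProbabilityMeasure μ] (hμ : μ Kᶜ = 0) {V : EuclideanSpace ℝ (Fin d) → ℝ}
    (hV : ContinuousOn V K) {S : EuclideanSpace ℝ (Fin d) → EuclideanSpace ℝ (Fin d)}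
    (hS : S ∈ candidateMaps K μ) : dualValue K μ ν V ≤ lagrangian μ ν V S := by
  unfold dualValue lagrangian
  exact add_le_add_left (integral_mono_ae (integrable_cTransform hK hμ hV)
    (integrable_cost_sub hK hμ hV hS) (cTransform_le_candidate hK hμ hV hS)) _

/-- A measurable map that almost attains the infimum in the definition of `V^c` everywhere. -/
lemma exists_measurable_near_minimizer (hK : IsCompact K) (hne : K.Nonempty)
    {V : EuclideanSpace ℝ (Fin d) → ℝ} (hV : ContinuousOn V K) {δ : ℝ} (hδ : 0 < δ) :
    ∃ S : EuclideanSpace ℝ (Fin d) → EuclideanSpace ℝ (Fin d), Measurable S ∧ (∀ x, S x ∈ K) ∧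
      ∀ x, cost x (S x) - V (S x) < cTransform K V x + δ := by
  classical
  have := hne.to_subtype
  let y : ℕ → K := TopologicalSpace.denseSeq K
  have hex : ∀ x, ∃ n, cost x (y n) - V (y n) < cTransform K V x + δ := by
    intro x
    obtain ⟨z, hz, hxz⟩ := exists_cTransform_eq hK hne hV x
    have hcont : Continuous fun w : K => cost x w - V w :=
      continuousOn_iff_continuous_domRestrict.1 (continuousOn_cost_sub hV x)
    have hopen : IsOpen {w : K | cost x w - V w < cTransform K V x + δ} :=
      isOpen_lt hcont continuous_const
    obtain ⟨w, hw, n, rfl⟩ := (TopologicalSpace.denseRange_denseSeq K).inter_open_nonempty _ hopen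
      ⟨⟨z, hz⟩, by simp only [mem_ofPred_eq]; linarith⟩
    exact ⟨n, hw⟩
  have hmeas : ∀ n, MeasurableSet {x | cost x (y n) - V (y n) < cTransform K V x + δ} := by
    intro n
    exact (isOpen_lt ((continuous_cost_left _).sub continuous_const)
      ((continuous_cTransform hK hne hV).add continuous_const)).measurableSet
  refine ⟨fun x => y (Nat.find (hex x)), ?_, fun x => (y _).2, fun x => Nat.find_spec (hex x)⟩
  exact (measurable_from_nat (f := fun n => (y n : EuclideanSpace ℝ (Fin d)))).comp
    (measurable_find hex hmeas)

lemma iInf_lagrangian (hK : IsCompact K) {μ ν : Measure (EuclideanSpace ℝ (Fin d))}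
    [IsProbabilityMeasure μ] (hμ : μ Kᶜ = 0) {V : EuclideanSpace ℝ (Fin d) → ℝ}
    (hV : ContinuousOn V K) :
    ⨅ S : candidateMaps K μ, lagrangian μ ν V S = dualValue K μ ν V := by
  have hne := nonempty_of_measure_compl hμ
  have : Nonempty (candidateMaps K μ) := ⟨⟨id, id_mem_candidateMaps μ⟩⟩
  refine le_antisymm (le_of_forall_pos_le_add fun δ hδ => ?_)
    (le_ciInf fun S => dualValue_le_lagrangian hK hμ hV S.2)
  obtain ⟨S, hSm, hSK, hS⟩ := exists_measurable_near_minimizer hK hne hV hδ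
  have hSc : S ∈ candidateMaps K μ := ⟨hSm.aemeasurable, fun x _ => hSK x⟩
  have hbdd : BddBelow (range fun S : candidateMaps K μ => lagrangian μ ν V S) :=
    ⟨dualValue K μ ν V, by rintro _ ⟨S, rfl⟩; exact dualValue_le_lagrangian hK hμ hV S.2⟩
  refine (ciInf_le hbdd ⟨S, hSc⟩).trans ?_
  have hint : ∫ x, (cost x (S x) - V (S x)) ∂μ ≤ ∫ x, (cTransform K V x + δ) ∂μ :=
    integral_mono (integrable_cost_sub hK hμ hV hSc)
      ((integrable_cTransform hK hμ hV).add (integrable_const δ)) fun x => (hS x).le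
  rw [integral_add (integrable_cTransform hK hμ hV) (integrable_const δ)] at hint
  simp only [integral_const, probReal_univ, one_smul] at hint
  simp only [lagrangian, dualValue]
  linarith

lemma lagrangian_eq_of_ae_eq {μ ν : Measure (EuclideanSpace ℝ (Fin d))}
    {V : EuclideanSpace ℝ (Fin d) → ℝ}
    {S : EuclideanSpace ℝ (Fin d) → EuclideanSpace ℝ (Fin d)}
    (h : ∀ᵐ x ∂μ, cTransform K V x = cost x (S x) - V (S x)) :
    lagrangian μ ν V S = dualValue K μ ν V := by
  rw [lagrangian, dualValue, integral_congr_ae h]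

lemma isOptimalPair_iff (hK : IsCompact K) {μ ν : Measure (EuclideanSpace ℝ (Fin d))}
    [IsProbabilityMeasure μ] (hμ : μ Kᶜ = 0) {V : EuclideanSpace ℝ (Fin d) → ℝ}
    {T : EuclideanSpace ℝ (Fin d) → EuclideanSpace ℝ (Fin d)} :
    IsOptimalPair K μ ν V T ↔ IsDualMaximizer K μ ν V ∧ T ∈ candidateMaps K μ ∧
      ∀ᵐ x ∂μ, cTransform K V x = cost x (T x) - V (T x) := by
  constructor
  · intro h
    have hV := h.continuousOn
    refine ⟨⟨hV, fun W hW => ?_⟩, h.mem, ?_⟩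
    · have := h.isMax W hW
      rwa [iInf_lagrangian hK hμ hW, iInf_lagrangian hK hμ hV] at this
    · have : Nonempty (candidateMaps K μ) := ⟨⟨T, h.mem⟩⟩
      have hle : lagrangian μ ν V T ≤ dualValue K μ ν V := by
        rw [← iInf_lagrangian hK hμ hV]
        exact le_ciInf fun S => h.isMin S S.2
      have heq := le_antisymm (dualValue_le_lagrangian hK hμ hV h.mem) hle
      simp only [dualValue, lagrangian, add_left_inj] at heq
      exact (integral_eq_iff_of_ae_le (integrable_cTransform hK hμ hV)
        (integrable_cost_sub hK hμ hV h.mem) (cTransform_le_candidate hK hμ hV h.mem)).1 heq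
  · rintro ⟨⟨hV, hmax⟩, hT, hae⟩
    refine ⟨hV, fun W hW => ?_, hT, fun S hS => ?_⟩
    · rw [iInf_lagrangian hK hμ hW, iInf_lagrangian hK hμ hV]
      exact hmax W hW
    · rw [lagrangian_eq_of_ae_eq hae]
      exact dualValue_le_lagrangian hK hμ hV hS

lemma dualValue_le_dualValue_cTransform_cTransform (hK : IsCompact K)
    {μ ν : Measure (EuclideanSpace ℝ (Fin d))} [IsProbabilityMeasure μ] [IsProbabilityMeasure ν]
    (hμ : μ Kᶜ = 0) (hν : ν Kᶜ = 0) {V : EuclideanSpace ℝ (Fin d) → ℝ} (hV : ContinuousOn V K) :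
    dualValue K μ ν V ≤ dualValue K μ ν (cTransform K (cTransform K V)) := by
  have hne := nonempty_of_measure_compl hμ
  have hc : ContinuousOn (cTransform K V) K := (continuous_cTransform hK hne hV).continuousOn
  unfold dualValue
  refine add_le_add (le_of_eq (integral_congr_ae ?_)) (integral_mono_ae
    (integrable_of_continuousOn hK hν hV) (integrable_cTransform hK hν hc) ?_)
  · filter_upwards [ae_mem_of_compl hμ] with x hx
    exact (cTransform_cTransform_cTransform hK hV hx).symm
  · filter_upwards [ae_mem_of_compl hν] with y hy using le_cTransform_cTransform hK hV hy

lemma IsDualMaximizer.cTransform_cTransform (hK : IsCompact K)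
    {μ ν : Measure (EuclideanSpace ℝ (Fin d))} [IsProbabilityMeasure μ] [IsProbabilityMeasure ν]
    (hμ : μ Kᶜ = 0) (hν : ν Kᶜ = 0) {V : EuclideanSpace ℝ (Fin d) → ℝ}
    (hV : IsDualMaximizer K μ ν V) :
    IsDualMaximizer K μ ν (cTransform K (cTransform K V)) := by
  have hne := nonempty_of_measure_compl hμ
  exact ⟨(continuous_cTransform hK hne
    (continuous_cTransform hK hne hV.1).continuousOn).continuousOn, fun W hW =>
      (hV.2 W hW).trans (dualValue_le_dualValue_cTransform_cTransform hK hμ hν hV.1)⟩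

lemma IsOptimalPair.cTransform_cTransform (hK : IsCompact K)
    {μ ν : Measure (EuclideanSpace ℝ (Fin d))} [IsProbabilityMeasure μ] [IsProbabilityMeasure ν]
    (hμ : μ Kᶜ = 0) (hν : ν Kᶜ = 0) {V : EuclideanSpace ℝ (Fin d) → ℝ}
    {T : EuclideanSpace ℝ (Fin d) → EuclideanSpace ℝ (Fin d)} (h : IsOptimalPair K μ ν V T) :
    IsOptimalPair K μ ν (cTransform K (cTransform K V)) T := by
  rw [isOptimalPair_iff hK hμ] at h ⊢
  obtain ⟨hV, hT, hae⟩ := h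
  have hVcc := hV.cTransform_cTransform hK hμ hν
  refine ⟨hVcc, hT, ?_⟩
  filter_upwards [hae, ae_mem_of_compl hμ] with x hx hxK
  have h1 := cTransform_le hK hVcc.1 x (hT.2 hxK)
  have h2 := le_cTransform_cTransform hK hV.1 (hT.2 hxK)
  rw [cTransform_cTransform_cTransform hK hV.1 hxK] at h1 ⊢
  linarith

lemma dualValue_sub_const (hK : IsCompact K)
    {μ ν : Measure (EuclideanSpace ℝ (Fin d))} [IsProbabilityMeasure μ] [IsProbabilityMeasure ν]
    (hμ : μ Kᶜ = 0) (hν : ν Kᶜ = 0) {V : EuclideanSpace ℝ (Fin d) → ℝ} (hV : ContinuousOn V K)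
    (a : ℝ) : dualValue K μ ν (fun y => V y - a) = dualValue K μ ν V := by
  have hne := nonempty_of_measure_compl hμ
  unfold dualValue
  rw [funext (cTransform_sub_const hK hne hV a),
    integral_add (integrable_cTransform hK hμ hV) (integrable_const a),
    integral_sub (integrable_of_continuousOn hK hν hV) (integrable_const a)]
  simp

lemma IsDualMaximizer.normalizedPotential (hK : IsCompact K)
    {μ ν : Measure (EuclideanSpace ℝ (Fin d))} [IsProbabilityMeasure μ] [IsProbabilityMeasure ν]
    (hμ : μ Kᶜ = 0) (hν : ν Kᶜ = 0) {V : EuclideanSpace ℝ (Fin d) → ℝ}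
    (hV : IsDualMaximizer K μ ν V) :
    IsDualMaximizer K μ ν (normalizedPotential K V) := by
  have hcc := hV.cTransform_cTransform hK hμ hν
  refine ⟨hcc.1.sub continuousOn_const, fun W hW => ?_⟩
  exact (hcc.2 W hW).trans_eq (dualValue_sub_const hK hμ hν hcc.1 _).symm

/-! ### Dual maximizers with differentiable `c`-transform give optimal Monge maps -/

/-- Where `V^c` is differentiable, points of `K` far from the minimizer are far from minimizing,
uniformly near the base point. -/
lemma exists_gap (hK : IsCompact K) (hne : K.Nonempty)
    {V : EuclideanSpace ℝ (Fin d) → ℝ} (hV : ContinuousOn V K) {x₀ : EuclideanSpace ℝ (Fin d)}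
    (hd : DifferentiableAt ℝ (cTransform K V) x₀) {δ : ℝ} (hδ : 0 < δ) :
    ∃ η > 0, ∀ᶠ x in 𝓝 x₀, ∀ y ∈ K, δ ≤ dist y (recoveredMap K V x₀) →
      η ≤ cost x y - V y - cTransform K V x := by
  obtain ⟨η, hη, hgap⟩ : ∃ η > 0, ∀ y ∈ K, δ ≤ dist y (recoveredMap K V x₀) →
      η ≤ cost x₀ y - V y - cTransform K V x₀ := by
    have hfar : IsClosed {y | δ ≤ dist y (recoveredMap K V x₀)} :=
      isClosed_le continuous_const (continuous_id.dist continuous_const)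
    have hcomp : IsCompact (K ∩ {y | δ ≤ dist y (recoveredMap K V x₀)}) := hK.inter_right hfar
    rcases (K ∩ {y | δ ≤ dist y (recoveredMap K V x₀)}).eq_empty_or_nonempty with he | hne'
    · exact ⟨1, one_pos, fun y hy hyd => (he.le ⟨hy, hyd⟩).elim⟩
    · obtain ⟨y, ⟨hyK, hyd⟩, hmin⟩ := hcomp.exists_isMinOn hne'
        ((continuousOn_cost_sub hV x₀).mono inter_subset_left)
      refine ⟨cost x₀ y - V y - cTransform K V x₀, sub_pos.2 ?_, fun z hz hzd =>
        sub_le_sub_right (hmin ⟨hz, hzd⟩) _⟩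
      refine lt_of_le_of_ne (cTransform_le hK hV x₀ hyK) fun h => ?_
      rw [recoveredMap_eq hK hV hyK h hd] at hyd
      simp only [mem_ofPred_eq, dist_self] at hyd
      linarith
  obtain ⟨R, hR⟩ := exists_norm_le hK
  have hcont : Continuous fun x => (cTransform K V x - (1 / 2) * ‖x‖ ^ 2) + ‖x - x₀‖ * R := by
    have := continuous_cTransform hK hne hV
    fun_prop
  have hlt : ∀ᶠ x in 𝓝 x₀, (cTransform K V x - (1 / 2) * ‖x‖ ^ 2) + ‖x - x₀‖ * R <
      (cTransform K V x₀ - (1 / 2) * ‖x₀‖ ^ 2) + η / 2 := by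
    refine hcont.continuousAt.eventually_lt continuousAt_const ?_
    simp only [sub_self, norm_zero, zero_mul]
    linarith
  refine ⟨η / 2, half_pos hη, hlt.mono fun x hx y hy hyd => ?_⟩
  have h1 := hgap y hy hyd
  have h2 : inner ℝ (x - x₀) y ≤ ‖x - x₀‖ * R :=
    (real_inner_le_norm _ _).trans (by gcongr; exact hR y hy)
  rw [inner_sub_left] at h2
  rw [cost_eq] at h1 ⊢
  linarith

/-- The directional derivative of `V ↦ V^c(x)` at a point of differentiability of `V^c`. -/
lemma tendsto_cTransform_slope (hK : IsCompact K) (hne : K.Nonempty)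
    {V : EuclideanSpace ℝ (Fin d) → ℝ} (hV : ContinuousOn V K)
    {h : EuclideanSpace ℝ (Fin d) → ℝ} (hh : Continuous h) {x : EuclideanSpace ℝ (Fin d)}
    (hd : DifferentiableAt ℝ (cTransform K V) x) {t : ℕ → ℝ} (ht : ∀ n, 0 < t n)
    (ht0 : Tendsto t atTop (𝓝 0)) :
    Tendsto (fun n => (cTransform K (fun y => V y + t n * h y) x - cTransform K V x) / t n) atTop
      (𝓝 (-h (recoveredMap K V x))) := by
  have hVt : ∀ n, ContinuousOn (fun y => V y + t n * h y) K := fun n =>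
    hV.add (continuousOn_const.mul hh.continuousOn)
  choose y hyK hy using fun n => exists_cTransform_eq hK hne (hVt n) x
  obtain ⟨hTK, hT⟩ := recoveredMap_mem_and_eq hK hne hV hd
  obtain ⟨C, hC⟩ := hK.exists_bound_of_continuousOn hh.continuousOn
  simp only [Real.norm_eq_abs] at hC
  have hup : ∀ n, cTransform K (fun y => V y + t n * h y) x - cTransform K V x ≤
      t n * -h (recoveredMap K V x) := fun n => by
    have := cTransform_le hK (hVt n) x hTK
    linarith
  have hlow : ∀ n, t n * -h (y n) ≤
      cTransform K (fun y => V y + t n * h y) x - cTransform K V x := fun n => by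
    have := cTransform_le hK hV x (hyK n)
    rw [hy n]
    linarith
  have hylim : Tendsto y atTop (𝓝 (recoveredMap K V x)) := by
    rw [Metric.tendsto_nhds]
    intro δ hδ
    obtain ⟨η, hη, hgap⟩ := exists_gap hK hne hV hd hδ
    have hsmall : ∀ᶠ n in atTop, t n * (2 * C) < η := by
      have : Tendsto (fun n => t n * (2 * C)) atTop (𝓝 0) := by
        simpa using ht0.mul_const (2 * C)
      exact this.eventually_lt_const hη
    filter_upwards [hsmall] with n hn
    by_contra hfar
    have h1 := hgap.self_of_nhds (y n) (hyK n) (not_lt.1 hfar)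
    have h2 := hup n
    rw [hy n] at h2
    have h3 : h (y n) - h (recoveredMap K V x) ≤ 2 * C := by
      linarith [(abs_le.1 (hC _ (hyK n))).2, (abs_le.1 (hC _ hTK)).1]
    have h4 := mul_le_mul_of_nonneg_left h3 (ht n).le
    linarith
  refine tendsto_of_tendsto_of_tendsto_of_le_of_le
    ((hh.tendsto _).comp hylim).neg tendsto_const_nhds (fun n => ?_) fun n => ?_
  · exact (le_div_iff₀' (ht n)).2 (hlow n)
  · exact (div_le_iff₀' (ht n)).2 (hup n)

lemma IsDualMaximizer.integral_le (hK : IsCompact K)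
    {μ ν : Measure (EuclideanSpace ℝ (Fin d))} [IsProbabilityMeasure μ] [IsProbabilityMeasure ν]
    (hμ : μ Kᶜ = 0) (hν : ν Kᶜ = 0) {V : EuclideanSpace ℝ (Fin d) → ℝ}
    (hV : IsDualMaximizer K μ ν V) (hd : ∀ᵐ x ∂μ, DifferentiableAt ℝ (cTransform K V) x)
    {h : EuclideanSpace ℝ (Fin d) → ℝ} (hh : Continuous h) :
    ∫ y, h y ∂ν ≤ ∫ x, h (recoveredMap K V x) ∂μ := by
  have hne := nonempty_of_measure_compl hμ
  let t : ℕ → ℝ := fun n => 1 / ((n : ℝ) + 1)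
  have ht : ∀ n, 0 < t n := fun n => by positivity
  have ht0 : Tendsto t atTop (𝓝 0) := tendsto_one_div_add_atTop_nhds_zero_nat
  obtain ⟨C, hC⟩ := hK.exists_bound_of_continuousOn hh.continuousOn
  simp only [Real.norm_eq_abs] at hC
  have hVt : ∀ n, ContinuousOn (fun y => V y + t n * h y) K := fun n =>
    hV.1.add (continuousOn_const.mul hh.continuousOn)
  have hint := fun n => integrable_cTransform hK hμ (hVt n)
  have hlim : Tendsto
      (fun n => ∫ x, (cTransform K (fun y => V y + t n * h y) x - cTransform K V x) / t n ∂μ) atTop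
      (𝓝 (∫ x, -h (recoveredMap K V x) ∂μ)) := by
    refine tendsto_integral_of_dominated_convergence (fun _ => C) (fun n => ?_)
      (integrable_const C) (fun n => ?_) ?_
    · exact (((hint n).sub (integrable_cTransform hK hμ hV.1)).div_const _).aestronglyMeasurable
    · refine Eventually.of_forall fun x => ?_
      rw [Real.norm_eq_abs, abs_div, abs_of_pos (ht n), div_le_iff₀' (ht n)]
      refine abs_cTransform_sub_le hK hne hV.1 (hVt n) (fun y hy => ?_) x
      rw [add_sub_cancel_left, abs_mul, abs_of_pos (ht n)]
      exact mul_le_mul_of_nonneg_left (hC y hy) (ht n).le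
    · filter_upwards [hd] with x hx using tendsto_cTransform_slope hK hne hV.1 hh hx ht ht0
  have hbound : ∀ n, ∫ x, (cTransform K (fun y => V y + t n * h y) x - cTransform K V x) / t n ∂μ ≤
      -∫ y, h y ∂ν := fun n => by
    have hmax := hV.2 _ (hVt n)
    unfold dualValue at hmax
    rw [integral_add (integrable_of_continuousOn hK hν hV.1)
      ((integrable_of_continuousOn hK hν hh.continuousOn).const_mul _), integral_const_mul] at hmax
    rw [integral_div, div_le_iff₀' (ht n),
      integral_sub (hint n) (integrable_cTransform hK hμ hV.1)]
    linarith
  have := le_of_tendsto' hlim hbound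
  rw [integral_neg] at this
  linarith

lemma IsDualMaximizer.map_recoveredMap (hK : IsCompact K)
    {μ ν : Measure (EuclideanSpace ℝ (Fin d))} [IsProbabilityMeasure μ] [IsProbabilityMeasure ν]
    (hμ : μ Kᶜ = 0) (hν : ν Kᶜ = 0) {V : EuclideanSpace ℝ (Fin d) → ℝ}
    (hV : IsDualMaximizer K μ ν V) (hd : ∀ᵐ x ∂μ, DifferentiableAt ℝ (cTransform K V) x) :
    μ.map (recoveredMap K V) = ν := by
  have hm := measurable_recoveredMap (K := K) V
  have : IsProbabilityMeasure (μ.map (recoveredMap K V)) :=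
    Measure.isProbabilityMeasure_map hm.aemeasurable
  refine ext_of_forall_integral_eq_of_IsFiniteMeasure fun f => ?_
  rw [integral_map hm.aemeasurable f.continuous.aestronglyMeasurable]
  refine le_antisymm ?_ (hV.integral_le hK hμ hν hd f.continuous)
  have := hV.integral_le hK hμ hν hd (h := fun y => -f y) f.continuous.neg
  simp only [integral_neg] at this
  linarith

lemma lagrangian_eq_integral_cost (hK : IsCompact K)
    {μ ν : Measure (EuclideanSpace ℝ (Fin d))} [IsProbabilityMeasure μ] [IsProbabilityMeasure ν]
    (hμ : μ Kᶜ = 0) (hν : ν Kᶜ = 0) {V : EuclideanSpace ℝ (Fin d) → ℝ} (hV : ContinuousOn V K)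
    {S : EuclideanSpace ℝ (Fin d) → EuclideanSpace ℝ (Fin d)} (hS : S ∈ candidateMaps K μ)
    (hmap : μ.map S = ν) : lagrangian μ ν V S = ∫ x, cost x (S x) ∂μ := by
  have h1 : Integrable (fun x => cost x (S x)) μ :=
    integrable_comp_candidate hK hμ continuous_cost.continuousOn hS
  have h2 : Integrable (fun x => V (S x)) μ :=
    integrable_comp_candidate hK hμ (F := fun p => V p.2)
      (hV.comp continuousOn_snd fun _ hp => hp.2) hS
  have h3 : ∫ y, V y ∂ν = ∫ x, V (S x) ∂μ := by
    rw [← hmap, integral_map hS.1]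
    rw [hmap]
    exact (integrable_of_continuousOn hK hν hV).1
  rw [lagrangian, integral_sub h1 h2, h3, sub_add_cancel]

lemma IsDualMaximizer.isOptimalPair_recoveredMap (hK : IsCompact K)
    {μ ν : Measure (EuclideanSpace ℝ (Fin d))} [IsProbabilityMeasure μ]
    (hμ : μ Kᶜ = 0) {V : EuclideanSpace ℝ (Fin d) → ℝ}
    (hV : IsDualMaximizer K μ ν V) (hd : ∀ᵐ x ∂μ, DifferentiableAt ℝ (cTransform K V) x) :
    IsOptimalPair K μ ν V (recoveredMap K V) := by
  rw [isOptimalPair_iff hK hμ]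
  refine ⟨hV, recoveredMap_mem_candidateMaps hK hV.1 μ, ?_⟩
  filter_upwards [hd] with x hx
  exact (recoveredMap_mem_and_eq hK (nonempty_of_measure_compl hμ) hV.1 hx).2

lemma IsDualMaximizer.isOptimalMongeMap (hK : IsCompact K)
    {μ ν : Measure (EuclideanSpace ℝ (Fin d))} [IsProbabilityMeasure μ] [IsProbabilityMeasure ν]
    (hμ : μ Kᶜ = 0) (hν : ν Kᶜ = 0) {V : EuclideanSpace ℝ (Fin d) → ℝ}
    (hV : IsDualMaximizer K μ ν V) (hd : ∀ᵐ x ∂μ, DifferentiableAt ℝ (cTransform K V) x) :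
    IsOptimalMongeMap K μ ν (recoveredMap K V) := by
  have hT := recoveredMap_mem_candidateMaps hK hV.1 μ
  have hmap := hV.map_recoveredMap hK hμ hν hd
  refine ⟨hT, hmap, fun S hS hSmap => ?_⟩
  rw [← lagrangian_eq_integral_cost hK hμ hν hV.1 hT hmap,
    ← lagrangian_eq_integral_cost hK hμ hν hV.1 hS hSmap]
  exact (hV.isOptimalPair_recoveredMap hK hμ hd).isMin S hS

/-- For an absolutely continuous source, the map of an optimal pair is a transport map. -/
lemma IsOptimalPair.map_eq (hK : IsCompact K)
    {μ ν : Measure (EuclideanSpace ℝ (Fin d))} [IsProbabilityMeasure μ] [IsProbabilityMeasure ν]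
    (hμ : μ Kᶜ = 0) (hν : ν Kᶜ = 0) (hac : μ ≪ volume) {V : EuclideanSpace ℝ (Fin d) → ℝ}
    {T : EuclideanSpace ℝ (Fin d) → EuclideanSpace ℝ (Fin d)} (h : IsOptimalPair K μ ν V T) :
    μ.map T = ν := by
  obtain ⟨hV, hT, hae⟩ := (isOptimalPair_iff hK hμ).1 h
  have hd : ∀ᵐ x ∂μ, DifferentiableAt ℝ (cTransform K V) x :=
    hac.ae_le (ae_differentiableAt_cTransform hK (nonempty_of_measure_compl hμ) hV.1)
  rw [← hV.map_recoveredMap hK hμ hν hd]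
  refine Measure.map_congr ?_
  filter_upwards [hd, hae, ae_mem_of_compl hμ] with x hx hxT hxK
  exact (recoveredMap_eq hK hV.1 (hT.2 hxK) hxT hx).symm

/-! ### Compactness of normalized potentials and stability of the dual problem -/

lemma abs_cTransform_sub_cTransform_le (hK : IsCompact K) (hne : K.Nonempty)
    {V : EuclideanSpace ℝ (Fin d) → ℝ} (hV : ContinuousOn V K) {R : NNReal}
    (hR : ∀ y ∈ K, ‖y‖ ≤ R) {y z : EuclideanSpace ℝ (Fin d)} (hy : ‖y‖ ≤ R) (hz : ‖z‖ ≤ R) :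
    |cTransform K V y - cTransform K V z| ≤ 2 * R * dist y z := by
  have h1 := (lipschitzWith_cTransform_sub hK hne hV hR).dist_le_mul y z
  rw [Real.dist_eq] at h1
  have h2 : |(1 / 2) * ‖y‖ ^ 2 - (1 / 2) * ‖z‖ ^ 2| ≤ R * dist y z := by
    have h3 : (1 / 2) * ‖y‖ ^ 2 - (1 / 2) * ‖z‖ ^ 2 =
        (1 / 2) * (‖y‖ + ‖z‖) * (‖y‖ - ‖z‖) := by ring
    rw [h3, abs_mul, abs_of_nonneg (by positivity)]
    exact mul_le_mul (by linarith) (by rw [dist_eq_norm]; exact abs_norm_sub_norm_le y z)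
      (abs_nonneg _) R.coe_nonneg
  rw [abs_le] at h1 h2 ⊢
  constructor <;> linarith [h1.1, h1.2, h2.1, h2.2]

lemma exists_subseq_tendstoUniformlyOn (hK : IsCompact K) {f : ℕ → EuclideanSpace ℝ (Fin d) → ℝ}
    {L : NNReal} {B : ℝ} (hL : ∀ n, LipschitzOnWith L (f n) K) (hB : ∀ n, ∀ x ∈ K, |f n x| ≤ B) :
    ∃ s : ℕ → ℕ, StrictMono s ∧ ∃ g : EuclideanSpace ℝ (Fin d) → ℝ,
      TendstoUniformlyOn (fun n => f (s n)) g atTop K := by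
  have : CompactSpace K := isCompact_iff_compactSpace.1 hK
  let A : Set (BoundedContinuousFunction K ℝ) :=
    {g | LipschitzWith L g ∧ ∀ x, g x ∈ Icc (-B) B}
  have hA : IsCompact (closure A) := by
    refine BoundedContinuousFunction.arzela_ascoli (Icc (-B) B) isCompact_Icc A
      (fun g x hg => hg.2 x) ?_
    exact (LipschitzWith.uniformEquicontinuous _ L fun g : A => g.2.1).equicontinuous
  let F : ℕ → BoundedContinuousFunction K ℝ := fun n =>
    BoundedContinuousFunction.mkOfCompact ⟨fun x => f n x, (hL n).to_restrict.continuous⟩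
  obtain ⟨g, -, s, hs, hlim⟩ := hA.tendsto_subseq (x := F) fun n =>
    subset_closure ⟨(hL n).to_restrict, fun x => abs_le.1 (hB n x x.2)⟩
  refine ⟨s, hs, Function.extend Subtype.val g 0, ?_⟩
  rw [tendstoUniformlyOn_iff_tendstoUniformly_comp_coe,
    Function.extend_comp Subtype.val_injective]
  exact BoundedContinuousFunction.tendsto_iff_tendstoUniformly.1 hlim

lemma exists_subseq_normalizedPotential (hK : IsCompact K) (hne : K.Nonempty)
    {U : ℕ → EuclideanSpace ℝ (Fin d) → ℝ} (hU : ∀ᶠ n in atTop, ContinuousOn (U n) K) :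
    ∃ s : ℕ → ℕ, StrictMono s ∧ ∃ V₀ : EuclideanSpace ℝ (Fin d) → ℝ,
      TendstoUniformlyOn (fun n => normalizedPotential K (U (s n))) V₀ atTop K := by
  obtain ⟨R, hR⟩ := exists_norm_le hK
  obtain ⟨N, hN⟩ := eventually_atTop.1 hU
  have key : ∀ n y z, ‖y‖ ≤ R → ‖z‖ ≤ R →
      |cTransform K (cTransform K (U (n + N))) y - cTransform K (cTransform K (U (n + N))) z| ≤
        2 * R * dist y z := fun n y z hy hz =>
    abs_cTransform_sub_cTransform_le hK hne
      (continuous_cTransform hK hne (hN _ (Nat.le_add_left _ _))).continuousOn hR hy hz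
  obtain ⟨s, hs, V₀, hV₀⟩ := exists_subseq_tendstoUniformlyOn hK
    (f := fun n => normalizedPotential K (U (n + N))) (L := 2 * R) (B := 2 * R * R)
    (fun n => LipschitzOnWith.of_dist_le_mul fun y hy z hz => by
      rw [Real.dist_eq, normalizedPotential, normalizedPotential, sub_sub_sub_cancel_right]
      exact_mod_cast key n y z (hR y hy) (hR z hz))
    (fun n y hy => by
      refine (key n y 0 (hR y hy) (by simp)).trans ?_
      rw [dist_zero_right]
      gcongr
      exact hR y hy)
  exact ⟨fun n => s n + N, hs.add_const N, V₀, hV₀⟩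

lemma abs_dualValue_sub_le (hK : IsCompact K)
    {μ ν : Measure (EuclideanSpace ℝ (Fin d))} [IsProbabilityMeasure μ] [IsProbabilityMeasure ν]
    (hμ : μ Kᶜ = 0) (hν : ν Kᶜ = 0) {V W : EuclideanSpace ℝ (Fin d) → ℝ}
    (hV : ContinuousOn V K) (hW : ContinuousOn W K) {a : ℝ} (h : ∀ y ∈ K, |W y - V y| ≤ a) :
    |dualValue K μ ν W - dualValue K μ ν V| ≤ 2 * a := by
  have hne := nonempty_of_measure_compl hμ
  have h1 : |∫ x, (cTransform K W x - cTransform K V x) ∂μ| ≤ a := by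
    have := norm_integral_le_of_norm_le_const (μ := μ) (C := a)
      (f := fun x => cTransform K W x - cTransform K V x)
      (Eventually.of_forall fun x => abs_cTransform_sub_le hK hne hV hW h x)
    simpa using this
  have h2 : |∫ y, (W y - V y) ∂ν| ≤ a := by
    have := norm_integral_le_of_norm_le_const (μ := ν) (C := a)
      (f := fun y => W y - V y) ((ae_mem_of_compl hν).mono fun y hy => h y hy)
    simpa using this
  rw [integral_sub (integrable_cTransform hK hμ hW) (integrable_cTransform hK hμ hV)] at h1
  rw [integral_sub (integrable_of_continuousOn hK hν hW) (integrable_of_continuousOn hK hν hV)] at h2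
  unfold dualValue
  rw [abs_le] at h1 h2 ⊢
  constructor <;> linarith [h1.1, h1.2, h2.1, h2.2]

lemma tendsto_integral_of_compact (hK : IsCompact K) {ι : Type*} {l : Filter ι}
    {μs : ι → ProbabilityMeasure (EuclideanSpace ℝ (Fin d))}
    {μ₀ : ProbabilityMeasure (EuclideanSpace ℝ (Fin d))} (hlim : Tendsto μs l (𝓝 μ₀))
    (hμs : ∀ᶠ i in l, (μs i : Measure (EuclideanSpace ℝ (Fin d))) Kᶜ = 0)
    (hμ₀ : (μ₀ : Measure (EuclideanSpace ℝ (Fin d))) Kᶜ = 0)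
    {f : EuclideanSpace ℝ (Fin d) → ℝ} (hf : Continuous f) :
    Tendsto (fun i => ∫ x, f x ∂(μs i : Measure (EuclideanSpace ℝ (Fin d)))) l
      (𝓝 (∫ x, f x ∂(μ₀ : Measure (EuclideanSpace ℝ (Fin d))))) := by
  obtain ⟨C, hC⟩ := hK.exists_bound_of_continuousOn hf.continuousOn
  let g : BoundedContinuousFunction (EuclideanSpace ℝ (Fin d)) ℝ :=
    BoundedContinuousFunction.ofNormedAddCommGroup (fun x => max (-|C|) (min |C| (f x)))
      (by fun_prop) |C| fun x => abs_le.2 ⟨le_max_left _ _,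
        max_le (by linarith [abs_nonneg C]) (min_le_left _ _)⟩
  have hg : ∀ x ∈ K, g x = f x := fun x hx => by
    have h := abs_le.1 ((hC x hx).trans (le_abs_self C))
    change max (-|C|) (min |C| (f x)) = f x
    rw [min_eq_right h.2, max_eq_right h.1]
  have hgi : ∀ μ : Measure (EuclideanSpace ℝ (Fin d)), μ Kᶜ = 0 → ∫ x, g x ∂μ = ∫ x, f x ∂μ :=
    fun μ hμ => integral_congr_ae ((ae_mem_of_compl hμ).mono hg)
  rw [← hgi _ hμ₀]
  refine (ProbabilityMeasure.tendsto_iff_forall_integral_tendsto.1 hlim g).congr' ?_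
  filter_upwards [hμs] with i hi using hgi _ hi

lemma measure_compl_eq_zero_of_tendsto (hK : IsClosed K) {ι : Type*} {l : Filter ι} [l.NeBot]
    {μs : ι → ProbabilityMeasure (EuclideanSpace ℝ (Fin d))}
    {μ₀ : ProbabilityMeasure (EuclideanSpace ℝ (Fin d))} (hlim : Tendsto μs l (𝓝 μ₀))
    (hμs : ∀ᶠ i in l, (μs i : Measure (EuclideanSpace ℝ (Fin d))) Kᶜ = 0) :
    (μ₀ : Measure (EuclideanSpace ℝ (Fin d))) Kᶜ = 0 := by
  have h := ProbabilityMeasure.le_liminf_measure_open_of_tendsto hlim hK.isOpen_compl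
  rw [liminf_congr hμs, liminf_const] at h
  exact le_antisymm h zero_le

lemma tendsto_dualValue (hK : IsCompact K) {ι : Type*} {l : Filter ι}
    {μs : ι → ProbabilityMeasure (EuclideanSpace ℝ (Fin d))}
    {μ₀ ν : ProbabilityMeasure (EuclideanSpace ℝ (Fin d))} (hlim : Tendsto μs l (𝓝 μ₀))
    (hμs : ∀ᶠ i in l, (μs i : Measure (EuclideanSpace ℝ (Fin d))) Kᶜ = 0)
    (hμ₀ : (μ₀ : Measure (EuclideanSpace ℝ (Fin d))) Kᶜ = 0)
    (hν : (ν : Measure (EuclideanSpace ℝ (Fin d))) Kᶜ = 0)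
    {W : ι → EuclideanSpace ℝ (Fin d) → ℝ} {V : EuclideanSpace ℝ (Fin d) → ℝ}
    (hW : ∀ᶠ i in l, ContinuousOn (W i) K) (hV : ContinuousOn V K)
    (hWV : TendstoUniformlyOn W V l K) :
    Tendsto (fun i => dualValue K (μs i) ν (W i)) l (𝓝 (dualValue K μ₀ ν V)) := by
  have h1 : Tendsto (fun i => dualValue K (μs i) ν V) l (𝓝 (dualValue K μ₀ ν V)) :=
    (tendsto_integral_of_compact hK hlim hμs hμ₀
      (continuous_cTransform hK (nonempty_of_measure_compl hμ₀) hV)).add_const _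
  have h2 : Tendsto (fun i => dualValue K (μs i) ν (W i) - dualValue K (μs i) ν V) l (𝓝 0) := by
    rw [Metric.tendsto_nhds]
    intro ε hε
    filter_upwards [hμs, hW, Metric.tendstoUniformlyOn_iff.1 hWV (ε / 3) (by positivity)]
      with i hi hWi hclose
    rw [Real.dist_0_eq_abs]
    refine (abs_dualValue_sub_le hK hi hν hV hWi (a := ε / 3) fun y hy => ?_).trans_lt (by linarith)
    rw [← Real.dist_eq, dist_comm]
    exact (hclose y hy).le
  simpa using h2.add h1

lemma isDualMaximizer_of_tendsto (hK : IsCompact K) {ι : Type*} {l : Filter ι} [l.NeBot]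
    {μs : ι → ProbabilityMeasure (EuclideanSpace ℝ (Fin d))}
    {μ₀ ν : ProbabilityMeasure (EuclideanSpace ℝ (Fin d))} (hlim : Tendsto μs l (𝓝 μ₀))
    (hμs : ∀ᶠ i in l, (μs i : Measure (EuclideanSpace ℝ (Fin d))) Kᶜ = 0)
    (hν : (ν : Measure (EuclideanSpace ℝ (Fin d))) Kᶜ = 0)
    {W : ι → EuclideanSpace ℝ (Fin d) → ℝ} {V : EuclideanSpace ℝ (Fin d) → ℝ}
    (hW : ∀ᶠ i in l, IsDualMaximizer K (μs i) ν (W i)) (hWV : TendstoUniformlyOn W V l K) :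
    IsDualMaximizer K μ₀ ν V := by
  have hμ₀ := measure_compl_eq_zero_of_tendsto hK.isClosed hlim hμs
  have hWc : ∀ᶠ i in l, ContinuousOn (W i) K := hW.mono fun i hi => hi.1
  have hV : ContinuousOn V K := hWV.continuousOn hWc.frequently
  refine ⟨hV, fun U hU => ?_⟩
  have h1 := tendsto_dualValue hK hlim hμs hμ₀ hν hWc hV hWV
  have h2 := tendsto_dualValue hK hlim hμs hμ₀ hν (Eventually.of_forall fun _ => hU) hU
    (Metric.tendstoUniformlyOn_iff.2 fun ε hε => by simp [hε])
  exact le_of_tendsto_of_tendsto h2 h1 (hW.mono fun i hi => hi.2 U hU)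

/-- The maximal dual values converge along the whole family, whatever the chosen maximizers. -/
lemma tendsto_dualValue_of_isDualMaximizer (hK : IsCompact K) {ι : Type*} {l : Filter ι} [l.NeBot]
    [l.IsCountablyGenerated]
    {μs : ι → ProbabilityMeasure (EuclideanSpace ℝ (Fin d))}
    {μ₀ ν : ProbabilityMeasure (EuclideanSpace ℝ (Fin d))} (hlim : Tendsto μs l (𝓝 μ₀))
    (hμs : ∀ᶠ i in l, (μs i : Measure (EuclideanSpace ℝ (Fin d))) Kᶜ = 0)
    (hν : (ν : Measure (EuclideanSpace ℝ (Fin d))) Kᶜ = 0)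
    {V : ι → EuclideanSpace ℝ (Fin d) → ℝ} {V₀ : EuclideanSpace ℝ (Fin d) → ℝ}
    (hV : ∀ᶠ i in l, IsDualMaximizer K (μs i) ν (V i)) (hV₀ : IsDualMaximizer K μ₀ ν V₀) :
    Tendsto (fun i => dualValue K (μs i) ν (V i)) l (𝓝 (dualValue K μ₀ ν V₀)) := by
  have hμ₀ := measure_compl_eq_zero_of_tendsto hK.isClosed hlim hμs
  refine tendsto_of_subseq_tendsto fun e he => ?_
  obtain ⟨s, hs, U, hU⟩ := exists_subseq_normalizedPotential hK (nonempty_of_measure_compl hμ₀)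
    (U := fun n => V (e n)) (he.eventually (hV.mono fun i hi => hi.1))
  have hes : Tendsto (fun n => e (s n)) atTop l := he.comp hs.tendsto_atTop
  have hμes := hes.eventually hμs
  have hVes := hes.eventually hV
  have hnorm : ∀ᶠ n in atTop, IsDualMaximizer K (μs (e (s n))) ν
      (normalizedPotential K (V (e (s n)))) := by
    filter_upwards [hμes, hVes] with n h1 h2 using h2.normalizedPotential hK h1 hν
  have hUmax : IsDualMaximizer K μ₀ ν U :=
    isDualMaximizer_of_tendsto hK (hlim.comp hes) hμes hν hnorm hU
  have heq : dualValue K μ₀ ν U = dualValue K μ₀ ν V₀ :=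
    le_antisymm (hV₀.2 U hUmax.1) (hUmax.2 V₀ hV₀.1)
  refine ⟨s, ?_⟩
  rw [← heq]
  refine (tendsto_dualValue hK (hlim.comp hes) hμes hμ₀ hν (hnorm.mono fun n h => h.1) hUmax.1
    hU).congr' ?_
  filter_upwards [hnorm, hVes] with n h1 h2 using le_antisymm (h2.2 _ h1.1) (h1.2 _ h2.1)

/-! ### Convergence of the maps -/

lemma eventually_exists_near (hK : IsCompact K) {ι : Type*} {l : Filter ι} [l.NeBot]
    [l.IsCountablyGenerated]
    {μs : ι → ProbabilityMeasure (EuclideanSpace ℝ (Fin d))}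
    {μ₀ ν : ProbabilityMeasure (EuclideanSpace ℝ (Fin d))} (hlim : Tendsto μs l (𝓝 μ₀))
    (hμs : ∀ᶠ i in l, (μs i : Measure (EuclideanSpace ℝ (Fin d))) Kᶜ = 0)
    (hν : (ν : Measure (EuclideanSpace ℝ (Fin d))) Kᶜ = 0)
    {V : ι → EuclideanSpace ℝ (Fin d) → ℝ} {V₀ : EuclideanSpace ℝ (Fin d) → ℝ}
    {T : ι → EuclideanSpace ℝ (Fin d) → EuclideanSpace ℝ (Fin d)}
    (hVT : ∀ᶠ i in l, IsOptimalPair K (μs i) ν (V i) (T i))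
    (hmap : ∀ᶠ i in l, (μs i : Measure (EuclideanSpace ℝ (Fin d))).map (T i) = ν)
    (hV₀ : IsDualMaximizer K μ₀ ν V₀) {x₀ : EuclideanSpace ℝ (Fin d)}
    (hx₀ : x₀ ∈ (μ₀ : Measure (EuclideanSpace ℝ (Fin d))).support)
    (hd : DifferentiableAt ℝ (cTransform K V₀) x₀) {δ : ℝ} (hδ : 0 < δ) :
    ∀ᶠ i in l, ∃ z ∈ K, dist z x₀ < δ ∧ dist (T i z) (recoveredMap K V₀ x₀) < δ := by
  have hμ₀ := measure_compl_eq_zero_of_tendsto hK.isClosed hlim hμs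
  have hne := nonempty_of_measure_compl hμ₀
  obtain ⟨η, hη, hgap⟩ := exists_gap hK hne hV₀.1 hd hδ
  obtain ⟨r, hr, hball⟩ := Metric.eventually_nhds_iff_ball.1 hgap
  set U := Metric.ball x₀ (min r δ) with hU
  have hpos : 0 < (μ₀ : Measure (EuclideanSpace ℝ (Fin d))) U :=
    Measure.mem_support_iff_forall x₀ |>.1 hx₀ U (Metric.ball_mem_nhds x₀ (lt_min hr hδ))
  obtain ⟨c, hc0, hc⟩ := ENNReal.lt_iff_exists_nnreal_btwn.1 hpos
  have hmass : ∀ᶠ i in l, (c : ENNReal) < (μs i : Measure (EuclideanSpace ℝ (Fin d))) U :=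
    eventually_lt_of_lt_liminf
      (hc.trans_le (ProbabilityMeasure.le_liminf_measure_open_of_tendsto hlim Metric.isOpen_ball))
  have hmax : ∀ᶠ i in l, IsDualMaximizer K (μs i) ν (V i) := by
    filter_upwards [hVT, hμs] with i h1 h2 using ((isOptimalPair_iff hK h2).1 h1).1
  have hdiff : Tendsto (fun i => dualValue K (μs i) ν (V i) - dualValue K (μs i) ν V₀) l (𝓝 0) := by
    have h1 := tendsto_dualValue_of_isDualMaximizer hK hlim hμs hν hmax hV₀
    have h2 := tendsto_dualValue hK hlim hμs hμ₀ hν (Eventually.of_forall fun _ => hV₀.1) hV₀.1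
      (Metric.tendstoUniformlyOn_iff.2 fun ε hε => by simp [hε])
    simpa using h1.sub h2
  have hηc : 0 < η * c := mul_pos hη (by exact_mod_cast hc0)
  filter_upwards [hmass, hVT, hμs, hmap, hdiff.eventually_lt_const hηc] with i hm hopt hi hpush hlt
  by_contra! hfar
  obtain ⟨hVi, hT, hae⟩ := (isOptimalPair_iff hK hi).1 hopt
  have hG1 := integrable_cost_sub hK hi hV₀.1 hT
  have hG2 := integrable_cTransform hK hi hV₀.1
  have hGint : ∫ x, (cost x (T i x) - V₀ (T i x) - cTransform K V₀ x) ∂(μs i : Measure _) =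
      dualValue K (μs i) ν (V i) - dualValue K (μs i) ν V₀ := by
    rw [← lagrangian_eq_of_ae_eq hae, lagrangian_eq_integral_cost hK hi hν hVi.1 hT hpush,
      ← lagrangian_eq_integral_cost hK hi hν hV₀.1 hT hpush, integral_sub hG1 hG2]
    simp only [lagrangian, dualValue]
    ring
  have hnonneg : 0 ≤ᵐ[(μs i : Measure (EuclideanSpace ℝ (Fin d)))]
      fun x => cost x (T i x) - V₀ (T i x) - cTransform K V₀ x := by
    filter_upwards [cTransform_le_candidate hK hi hV₀.1 hT] with x hx using sub_nonneg.2 hx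
  have hmarkov := mul_meas_ge_le_integral_of_nonneg hnonneg (hG1.sub hG2) η
  have hsub : (μs i : Measure (EuclideanSpace ℝ (Fin d))) U ≤ (μs i : Measure _)
      {x | η ≤ cost x (T i x) - V₀ (T i x) - cTransform K V₀ x} := by
    refine measure_mono_ae ?_
    filter_upwards [ae_mem_of_compl hi] with x hxK hxU
    have hxU' : dist x x₀ < min r δ := hxU
    exact hball x (hxU'.trans_le (min_le_left _ _)) _ (hT.2 hxK)
      (hfar x hxK (hxU'.trans_le (min_le_right _ _)))
  have hcle : (c : ℝ) ≤ (μs i : Measure (EuclideanSpace ℝ (Fin d))).real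
      {x | η ≤ cost x (T i x) - V₀ (T i x) - cTransform K V₀ x} := by
    have := ENNReal.toReal_mono (measure_ne_top _ _) (hm.le.trans hsub)
    simpa [Measure.real] using this
  rw [hGint] at hmarkov
  have := mul_le_mul_of_nonneg_left hcle hη.le
  linarith

lemma exists_tendsto_of_eventually_near {X : Type*} [PseudoMetricSpace X] {K : Set X}
    (hne : K.Nonempty) {T : ℝ → X → X} {x y : X}
    (h : ∀ δ > 0, ∀ᶠ ε in 𝓝[>] (0 : ℝ), ∃ z ∈ K, dist z x < δ ∧ dist (T ε z) y < δ) :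
    ∃ z : ℝ → X, (∀ ε, z ε ∈ K) ∧ Tendsto z (𝓝[>] 0) (𝓝 x) ∧
      Tendsto (fun ε => T ε (z ε)) (𝓝[>] 0) (𝓝 y) := by
  have := hne.to_subtype
  let g : ℝ → K → ℝ := fun ε z => max (dist (z : X) x) (dist (T ε z) y)
  have hbdd : ∀ ε, BddBelow (range (g ε)) := fun ε =>
    ⟨0, by rintro _ ⟨z, rfl⟩; exact le_max_of_le_left dist_nonneg⟩
  have hz : ∀ ε, ∃ z : K, 0 < ε → g ε z < (⨅ z, g ε z) + ε := fun ε => by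
    by_cases hε : 0 < ε
    · obtain ⟨z, hz⟩ := exists_lt_of_ciInf_lt (lt_add_of_pos_right (⨅ z, g ε z) hε)
      exact ⟨z, fun _ => hz⟩
    · exact ⟨Classical.arbitrary K, fun h => (hε h).elim⟩
  choose z hz using hz
  have key : ∀ δ > 0, ∀ᶠ ε in 𝓝[>] (0 : ℝ), g ε (z ε) < δ := fun δ hδ => by
    have hsmall : ∀ᶠ ε in 𝓝[>] (0 : ℝ), ε < δ / 2 :=
      (tendsto_nhdsWithin_of_tendsto_nhds tendsto_id).eventually_lt_const (half_pos hδ)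
    filter_upwards [h (δ / 2) (half_pos hδ), self_mem_nhdsWithin, hsmall] with ε hw hε hεδ
    obtain ⟨w, hwK, h1, h2⟩ := hw
    have h3 := ciInf_le (hbdd ε) ⟨w, hwK⟩
    have h4 : g ε ⟨w, hwK⟩ < δ / 2 := max_lt h1 h2
    have h5 := hz ε hε
    linarith
  refine ⟨fun ε => z ε, fun ε => (z ε).2, Metric.tendsto_nhds.2 fun δ hδ => ?_,
    Metric.tendsto_nhds.2 fun δ hδ => ?_⟩
  · exact (key δ hδ).mono fun ε hε => (le_max_left _ _).trans_lt hε
  · exact (key δ hδ).mono fun ε hε => (le_max_right _ _).trans_lt hε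

end SemiDualOT

theorem theorem4p1 {d : ℕ} (K : Set (EuclideanSpace ℝ (Fin d))) (hK : IsCompact K)
    (μ : ℝ → ProbabilityMeasure (EuclideanSpace ℝ (Fin d)))
    (μ₀ ν : ProbabilityMeasure (EuclideanSpace ℝ (Fin d)))
    (hμK : ∀ ε : ℝ, 0 < ε → (μ ε : Measure (EuclideanSpace ℝ (Fin d))) Kᶜ = 0)
    (hμac : ∀ ε : ℝ, 0 < ε → (μ ε : Measure (EuclideanSpace ℝ (Fin d))) ≪ volume)
    (hμlim : Tendsto μ (𝓝[>] 0) (𝓝 μ₀))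
    (hνK : (ν : Measure (EuclideanSpace ℝ (Fin d))) Kᶜ = 0)
    (V : ℝ → EuclideanSpace ℝ (Fin d) → ℝ)
    (T : ℝ → EuclideanSpace ℝ (Fin d) → EuclideanSpace ℝ (Fin d))
    (hopt : ∀ ε : ℝ, 0 < ε → SemiDualOT.IsOptimalPair K (μ ε) ν (V ε) (T ε)) :
    -- `(V_ε^{cc}, T_ε)` is optimal as well
    (∀ ε : ℝ, 0 < ε →
      SemiDualOT.IsOptimalPair K (μ ε) ν
        (SemiDualOT.cTransform K (SemiDualOT.cTransform K (V ε))) (T ε)) ∧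
    -- every sequence `ε_k ↓ 0` has a subsequence along which the normalized `V_ε^{cc}` converge
    (∀ e : ℕ → ℝ, Tendsto e atTop (𝓝[>] 0) →
      ∃ s : ℕ → ℕ, StrictMono s ∧ ∃ V₀ : EuclideanSpace ℝ (Fin d) → ℝ,
        TendstoUniformlyOn (fun k => SemiDualOT.normalizedPotential K (V (e (s k)))) V₀ atTop K) ∧
    -- for every limiting potential `V₀` obtained in this way
    (∀ (e : ℕ → ℝ) (V₀ : EuclideanSpace ℝ (Fin d) → ℝ), Tendsto e atTop (𝓝[>] 0) →
      TendstoUniformlyOn (fun k => SemiDualOT.normalizedPotential K (V (e k))) V₀ atTop K →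
      (∀ᵐ x ∂(μ₀ : Measure (EuclideanSpace ℝ (Fin d))),
        DifferentiableAt ℝ (SemiDualOT.cTransform K V₀) x) →
      SemiDualOT.IsOptimalMongeMap K μ₀ ν (SemiDualOT.recoveredMap K V₀) ∧
      ((∀ ε : ℝ, 0 < ε → DifferentiableOn ℝ (SemiDualOT.cTransform K (V ε)) K) →
        (∀ᵐ x ∂(μ₀ : Measure (EuclideanSpace ℝ (Fin d))),
          ∃ z : ℝ → EuclideanSpace ℝ (Fin d), (∀ ε : ℝ, 0 < ε → z ε ∈ K) ∧
            Tendsto z (𝓝[>] 0) (𝓝 x) ∧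
            Tendsto (fun ε => T ε (z ε)) (𝓝[>] 0) (𝓝 (SemiDualOT.recoveredMap K V₀ x))) ∧
        SemiDualOT.IsOptimalPair K μ₀ ν V₀ (SemiDualOT.recoveredMap K V₀))) := by
  have hK0 : ∀ᶠ ε in 𝓝[>] (0 : ℝ), (μ ε : Measure (EuclideanSpace ℝ (Fin d))) Kᶜ = 0 :=
    eventually_mem_nhdsWithin.mono fun ε hε => hμK ε hε
  have hμ₀K := SemiDualOT.measure_compl_eq_zero_of_tendsto hK.isClosed hμlim hK0
  have hne := SemiDualOT.nonempty_of_measure_compl hμ₀K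
  have hmax : ∀ ε : ℝ, 0 < ε → SemiDualOT.IsDualMaximizer K (μ ε) ν (V ε) := fun ε hε =>
    ((SemiDualOT.isOptimalPair_iff hK (hμK ε hε)).1 (hopt ε hε)).1
  have hVT : ∀ᶠ ε in 𝓝[>] (0 : ℝ), SemiDualOT.IsOptimalPair K (μ ε) ν (V ε) (T ε) :=
    eventually_mem_nhdsWithin.mono fun ε hε => hopt ε hε
  have hmap : ∀ᶠ ε in 𝓝[>] (0 : ℝ), (μ ε : Measure (EuclideanSpace ℝ (Fin d))).map (T ε) = ν :=
    eventually_mem_nhdsWithin.mono fun ε hε =>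
      (hopt ε hε).map_eq hK (hμK ε hε) hνK (hμac ε hε)
  refine ⟨fun ε hε => (hopt ε hε).cTransform_cTransform hK (hμK ε hε) hνK, fun e he => ?_,
    fun e V₀ he hV₀ hd => ?_⟩
  · have hpos : ∀ᶠ k in atTop, 0 < e k := he.eventually eventually_mem_nhdsWithin
    exact SemiDualOT.exists_subseq_normalizedPotential hK hne (U := fun k => V (e k))
      (hpos.mono fun k hk => (hopt _ hk).continuousOn)
  · have hpos : ∀ᶠ k in atTop, 0 < e k := he.eventually eventually_mem_nhdsWithin
    have hV₀max : SemiDualOT.IsDualMaximizer K μ₀ ν V₀ :=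
      SemiDualOT.isDualMaximizer_of_tendsto hK (hμlim.comp he) (he.eventually hK0) hνK
        (hpos.mono fun k hk => (hmax _ hk).normalizedPotential hK (hμK _ hk) hνK) hV₀
    refine ⟨hV₀max.isOptimalMongeMap hK hμ₀K hνK hd, fun _ => ⟨?_,
      hV₀max.isOptimalPair_recoveredMap hK hμ₀K hd⟩⟩
    filter_upwards [hd, Measure.support_mem_ae] with x hx hxs
    have hnear : ∀ δ > 0, ∀ᶠ ε in 𝓝[>] (0 : ℝ), ∃ z ∈ K, dist z x < δ ∧
        dist (T ε z) (SemiDualOT.recoveredMap K V₀ x) < δ := fun δ hδ =>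
      SemiDualOT.eventually_exists_near hK hμlim hK0 hνK hVT hmap hV₀max hxs hx hδ
    obtain ⟨z, hzK, hz, hTz⟩ := SemiDualOT.exists_tendsto_of_eventually_near hne hnear
    exact ⟨z, fun ε _ => hzK ε, hz, hTz⟩
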